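/- Let $\mathcal S=\mathbb R/2\mathbb Z$ be the circle of perimeter $2$ with its arc-length metric, let $\mu\in(0,\tfrac12]$, and let $\Omega=\mathcal S^{\mathbb Z}$ carry the product topology. The compass model on $\mathbb Z$ is the Markov process on $\Omega$ with generator $$\mathcal Lf(\eta)=\sum_{e=\langle u,u+1\rangle,\;u\in\mathbb Z}\Big(\tfrac12\big[f(A^{(1)}_e\eta)+f(A^{(2)}_e\eta)\big]-f(\eta)\Big)$$ for bounded measurable functions $f$ of finitely many coordinates. Here $A^{(k)}_e\eta$ is obtained from $\eta$ by moving the two opinions $\eta(u)$ and $\eta(u+1)$ towards each other along a geodesic (shortest arc) joining them, each by the proportion $\mu$ of their distance, all other opinions being unchanged; if $\eta(u)$ and $\eta(u+1)$ are diametrically opposed, $A^{(1)}_e$ and $A^{(2)}_e$ use the two different geodesics, and otherwise $A^{(1)}_e=A^{(2)}_e$. Its Markov semigroup is $S(t)f=\lim_{\Lambda\uparrow\mathbb Z}\exp(t\mathcal L_\Lambda)f$, where $\mathcal L_\Lambda$ is the part of the sum that belongs to the edges in the finite set $\Lambda$. Let $\mathcal I$ be the set of invariant measures, i.e. of Borel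 probability measures $\nu$ on $\Omega$ with $\int S(t)f\,d\nu=\int f\,d\nu$ for all $t\ge 0$ and all such $f$. For $s\in\mathcal S$ let $\bar s\in\Omega$ be the configuration with the constant value $s$, and $\delta_{\bar s}$ the point mass at $\bar s$. Then $\mathcal I$ is the closed convex hull (with respect to weak convergence) of $\{\delta_{\bar s} : s\in\mathcal S\}$. Equivalently, a probability measure $\nu$ on $\Omega$ belongs to $\mathcal I$ if and only if $\nu=\int_{\mathcal S}\delta_{\bar s}\,\rho(ds)$ for some Borel probability measure $\rho$ on $\mathcal S$. -/

import Mathlib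

open MeasureTheory Filter Topology
open scoped NNReal

namespace Compass

noncomputable section

instance fact_two_pos : Fact ((0 : ℝ) < 2) := ⟨two_pos⟩

/-- The space of opinions: the circle `ℝ / 2ℤ`, of perimeter `2`. -/
abbrev Opinion : Type := AddCircle (2 : ℝ)

/-- Configurations on the two-sided infinite path, with the product topology and the product
σ-algebra. The edge between `v` and `v + 1` is labelled by its left endpoint `v`. -/
abbrev Config : Type := ℤ → Opinion

/-- The unique representative of a point of the circle in the interval `(-1, 1]`. -/
def rep (x : Opinion) : ℝ := (AddCircle.equivIoc (2 : ℝ) (-1) x : ℝ)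

/-- The signed length, in `[-1, 1]`, of the geodesic from `x` to `y`. It is unique unless `x` and
`y` are diametrically opposed; in that case `k` selects one of the two geodesics. -/
def geodesic (k : Bool) (x y : Opinion) : ℝ :=
  if rep (y - x) = 1 ∧ k = true then -1 else rep (y - x)

/-- The update of the configuration `η` along the edge `e = ⟨e, e + 1⟩`: both incident opinions
move a proportion `μ` of their distance towards each other, along the geodesic selected by `k`. -/
def update (μ : ℝ) (k : Bool) (e : ℤ) (η : Config) : Config := fun v =>
  if v = e then η e + ((μ * geodesic k (η e) (η (e + 1)) : ℝ) : Opinion)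
  else if v = e + 1 then η (e + 1) - ((μ * geodesic k (η e) (η (e + 1)) : ℝ) : Opinion)
  else η v

/-- The part of the generator that belongs to the edges in the finite set `Λ`. The generator of
the compass model on `ℤ` is the sum over all edges, i.e. the limit of this as `Λ` exhausts `ℤ`. -/
def generatorOn (μ : ℝ) (Λ : Finset ℤ) (f : Config → ℝ) : Config → ℝ := fun η =>
  ∑ e ∈ Λ, ((1 / 2) * (f (update μ false e η) + f (update μ true e η)) - f η)

/-- The Markov semigroup `exp (t L_Λ)`, in which only the edges in `Λ` are updated. For bounded `f`
the operator `L_Λ` is bounded in the supremum norm, so the exponential series converges. -/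
def semigroupOn (μ : ℝ) (Λ : Finset ℤ) (t : ℝ) (f : Config → ℝ) : Config → ℝ := fun η =>
  ∑' n : ℕ, t ^ n / (n.factorial : ℝ) * ((generatorOn μ Λ)^[n] f) η

/-- The Markov semigroup `S(t)` of the compass model on `ℤ`, `S(t) f (η)` being the expectation of
`f (η_t)` for the process started in `η`: the limit of `exp (t L_Λ) f` as the finite edge sets `Λ`
exhaust all the edges. It exists (uniformly in `η`) for bounded functions `f` of finitely many
coordinates, because influence spreads over a random, almost surely finite range up to time `t`. -/
def semigroup (μ : ℝ) (t : ℝ) (f : Config → ℝ) : Config → ℝ := fun η =>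
  limUnder (atTop : Filter (Finset ℤ)) (fun Λ => semigroupOn μ Λ t f η)

/-- Bounded measurable functions of finitely many coordinates. -/
def IsLocalFunction (f : Config → ℝ) : Prop :=
  Measurable f ∧ (∃ C : ℝ, ∀ η, |f η| ≤ C) ∧ ∃ Λ : Finset ℤ, DependsOn f (Λ : Set ℤ)

/-- The set of invariant (probability) measures of the compass model: those `ν` with `ν S(t) = ν`
for all `t ≥ 0`. Local functions determine a probability measure on `Config`. -/
def invariantMeasures (μ : ℝ) : Set (ProbabilityMeasure Config) :=
  {ν | ∀ t : ℝ, 0 ≤ t → ∀ f : Config → ℝ, IsLocalFunction f →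
    ∫ η, semigroup μ t f η ∂(ν : Measure Config) = ∫ η, f η ∂(ν : Measure Config)}

/-- The configuration which assigns the value `s` to all vertices. -/
def constConfig (s : Opinion) : Config := fun _ => s

/-- The point mass at a configuration. -/
def pointMass (η : Config) : ProbabilityMeasure Config :=
  ⟨Measure.dirac η, inferInstance⟩

end

end Compass

/-! Let the gap of an edge be the distance between its two opinions. Updating an edge multiplies its
gap by `1 - 2μ`, and by the triangle inequality adds at most `μ` times the old gap to each
neighbouring gap; the shortfall is the `loss`. The generator applied to a gap is therefore `μ` times
the discrete Laplacian minus a nonnegative loss term. Under an invariant measure this has integral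
zero, so the expected gaps form a bounded convex sequence on `ℤ`. Such a sequence is constant, hence
almost surely no loss occurs (`integral_gap_and_loss`).

An almost surely vanishing nonnegative local function still vanishes after any update, so
losslessness persists along every finite list of updates (`ae_stablyLossless`). Lossless updates
redistribute gaps linearly. Repeated updates inside an interval push nearly all gap to its ends, yet
no edge can carry more than `1`; this bounds a weighted sum of gaps (`StablyLossless.sum_gap_le`).
Integrating, the common expected gap is at most `2 / (n + 2)` for all `n`, so it is zero and
configurations are almost surely constant.

Conversely, constant configurations are fixed by all updates. The closed convex hull is found from
the closed convex conditions of mass one and zero expected gaps, together with approximation by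
simple functions. -/

namespace Compass

/-! ### Measurability and locality of a single update -/

section Update

variable {μ : ℝ}

lemma measurable_rep : Measurable rep :=
  measurable_subtype_coe.comp (AddCircle.measurableEquivIoc (2 : ℝ) (-1)).measurable

lemma measurable_geodesic (k : Bool) :
    Measurable fun p : Opinion × Opinion => geodesic k p.1 p.2 := by
  have h : Measurable fun p : Opinion × Opinion => rep (p.2 - p.1) :=
    measurable_rep.comp (measurable_snd.sub measurable_fst)
  refine Measurable.ite ?_ measurable_const h
  by_cases hk : k = true
  · simp only [hk, and_true]
    exact measurableSet_eq_fun h measurable_const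
  · simp [hk]

lemma measurable_update (μ : ℝ) (k : Bool) (e : ℤ) : Measurable (update μ k e) := by
  have hg : Measurable fun η : Config => geodesic k (η e) (η (e + 1)) :=
    Measurable.comp (g := fun p : Opinion × Opinion => geodesic k p.1 p.2)
      (f := fun η : Config => (η e, η (e + 1))) (measurable_geodesic k)
      ((measurable_pi_apply e).prodMk (measurable_pi_apply (e + 1)))
  have h : Measurable fun η : Config =>
      ((μ * geodesic k (η e) (η (e + 1)) : ℝ) : Opinion) :=
    AddCircle.measurable_mk'.comp (hg.const_mul μ)
  refine measurable_pi_lambda _ fun v => ?_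
  unfold update
  split_ifs
  · exact (measurable_pi_apply e).add h
  · exact (measurable_pi_apply (e + 1)).sub h
  · exact measurable_pi_apply v

lemma update_apply_left (k : Bool) (e : ℤ) (η : Config) :
    update μ k e η e = η e + ((μ * geodesic k (η e) (η (e + 1)) : ℝ) : Opinion) := by
  simp [update]

lemma update_apply_right (k : Bool) (e : ℤ) (η : Config) :
    update μ k e η (e + 1) =
      η (e + 1) - ((μ * geodesic k (η e) (η (e + 1)) : ℝ) : Opinion) := by
  simp [update]

lemma update_apply_of_ne (k : Bool) {e v : ℤ} (η : Config) (h : v ≠ e) (h' : v ≠ e + 1) :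
    update μ k e η v = η v := by
  simp [update, h, h']

lemma update_congr (k : Bool) (e : ℤ) {η ζ : Config} (h : η e = ζ e)
    (h' : η (e + 1) = ζ (e + 1)) {v : ℤ} (hv : η v = ζ v) :
    update μ k e η v = update μ k e ζ v := by
  simp [update, h, h', hv]

end Update

/-! ### Short-time power series of the semigroup on local functions -/

section Generator

variable {μ : ℝ} {f : Config → ℝ} {a b : ℤ} {C : ℝ}

lemma measurable_generatorOn (Λ : Finset ℤ) (hf : Measurable f) :
    Measurable (generatorOn μ Λ f) := by
  unfold generatorOn
  refine Finset.measurable_fun_sum _ fun e _ => ?_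
  exact (((hf.comp (measurable_update μ false e)).add
    (hf.comp (measurable_update μ true e))).const_mul _).sub hf

lemma comp_update_of_notMem (hf : DependsOn f (Set.Icc a b)) (k : Bool) {e : ℤ}
    (he : e ∉ Set.Icc (a - 1) b) (η : Config) : f (update μ k e η) = f η := by
  refine hf fun v hv => ?_
  simp only [Set.mem_Icc] at he hv
  exact update_apply_of_ne k η (by rintro rfl; omega) (by rintro rfl; omega)

lemma generatorOn_eq_inter (hf : DependsOn f (Set.Icc a b)) (Λ : Finset ℤ) :
    generatorOn μ Λ f = generatorOn μ (Λ ∩ Finset.Icc (a - 1) b) f := by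
  funext η
  refine (Finset.sum_subset Finset.inter_subset_left fun e he he' => ?_).symm
  have : e ∉ Set.Icc (a - 1) b := by
    simpa [he] using he'
  rw [comp_update_of_notMem hf _ this, comp_update_of_notMem hf _ this]
  ring

lemma generatorOn_eq_of_subset (hf : DependsOn f (Set.Icc a b)) {Λ : Finset ℤ}
    (hΛ : Finset.Icc (a - 1) b ⊆ Λ) :
    generatorOn μ Λ f = generatorOn μ (Finset.Icc (a - 1) b) f := by
  rw [generatorOn_eq_inter hf, Finset.inter_eq_right.2 hΛ]

lemma dependsOn_generatorOn (hf : DependsOn f (Set.Icc a b)) (Λ : Finset ℤ) :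
    DependsOn (generatorOn μ Λ f) (Set.Icc (a - 1) (b + 1)) := by
  rw [generatorOn_eq_inter hf]
  intro η ζ h
  refine Finset.sum_congr rfl fun e he => ?_
  simp only [Finset.mem_inter, Finset.mem_Icc] at he
  have h1 : η e = ζ e := h e ⟨by omega, by omega⟩
  have h2 : η (e + 1) = ζ (e + 1) := h _ ⟨by omega, by omega⟩
  have h3 : ∀ v ∈ Set.Icc a b, η v = ζ v := fun v hv => h v ⟨by grind, by grind⟩
  have h4 : ∀ k, f (update μ k e η) = f (update μ k e ζ) := fun k =>
    hf fun v hv => update_congr k e h1 h2 (h3 v hv)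
  rw [h4, h4, hf h3]

lemma abs_generatorOn_le (hab : a ≤ b) (hf : DependsOn f (Set.Icc a b))
    (hC : ∀ η, |f η| ≤ C) (Λ : Finset ℤ) (η : Config) :
    |generatorOn μ Λ f η| ≤ 2 * (b - a + 2) * C := by
  have hC0 : 0 ≤ C := (abs_nonneg _).trans (hC η)
  rw [generatorOn_eq_inter hf]
  refine (Finset.abs_sum_le_sum_abs _ _).trans ?_
  refine (Finset.sum_le_card_nsmul _ _ (2 * C) fun e _ => ?_).trans ?_
  · have h1 := abs_le.1 (hC (update μ false e η))
    have h2 := abs_le.1 (hC (update μ true e η))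
    have h3 := abs_le.1 (hC η)
    rw [abs_le]
    constructor <;> linarith
  · have h : ((Λ ∩ Finset.Icc (a - 1) b).card : ℝ) ≤ b - a + 2 := by
      have h1 : (Λ ∩ Finset.Icc (a - 1) b).card ≤ (Finset.Icc (a - 1) b).card :=
        Finset.card_le_card Finset.inter_subset_right
      rw [Int.card_Icc] at h1
      have h2 : (((Λ ∩ Finset.Icc (a - 1) b).card : ℤ)) ≤ b - a + 2 := by omega
      exact_mod_cast h2
    rw [nsmul_eq_mul]
    nlinarith

lemma measurable_iterate_generatorOn (Λ : Finset ℤ) (hf : Measurable f) (n : ℕ) :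
    Measurable ((generatorOn μ Λ)^[n] f) := by
  induction n with
  | zero => exact hf
  | succ n ih =>
    rw [Function.iterate_succ_apply']
    exact measurable_generatorOn Λ ih

lemma dependsOn_iterate_generatorOn (hf : DependsOn f (Set.Icc a b)) (Λ : Finset ℤ) (n : ℕ) :
    DependsOn ((generatorOn μ Λ)^[n] f) (Set.Icc (a - n) (b + n)) := by
  induction n with
  | zero => simpa using hf
  | succ n ih =>
    rw [Function.iterate_succ_apply']
    convert dependsOn_generatorOn ih Λ using 2 <;> push_cast <;> ring

/-- Each application of the generator enlarges the dependence interval by one site on either side,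
so `n` applications only see edges in `[a - n, b + n]`. -/
lemma iterate_generatorOn_eq (hf : DependsOn f (Set.Icc a b)) (n : ℕ) {Λ Λ' : Finset ℤ}
    (hΛ : Finset.Icc (a - n) (b + n) ⊆ Λ) (hΛ' : Finset.Icc (a - n) (b + n) ⊆ Λ') :
    (generatorOn μ Λ)^[n] f = (generatorOn μ Λ')^[n] f := by
  induction n with
  | zero => rfl
  | succ n ih =>
    have h1 : Finset.Icc (a - n) (b + n) ⊆ Finset.Icc (a - (n + 1 : ℕ)) (b + (n + 1 : ℕ)) :=
      Finset.Icc_subset_Icc (by push_cast; omega) (by push_cast; omega)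
    have h2 : Finset.Icc (a - n - 1) (b + n) ⊆
        Finset.Icc (a - (n + 1 : ℕ)) (b + (n + 1 : ℕ)) :=
      Finset.Icc_subset_Icc (by push_cast; omega) (by push_cast; omega)
    have h := dependsOn_iterate_generatorOn (μ := μ) hf
    rw [Function.iterate_succ_apply', Function.iterate_succ_apply',
      generatorOn_eq_of_subset (h Λ n) (h2.trans hΛ), generatorOn_eq_of_subset (h Λ' n) (h2.trans hΛ'),
      ih (h1.trans hΛ) (h1.trans hΛ')]

/-- The linear growth of the dependence interval produces the factorial. It cancels the `n!` of the
exponential series, which leaves a geometric bound uniform in `Λ`. -/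
lemma abs_iterate_generatorOn_le (hab : a ≤ b) (hf : DependsOn f (Set.Icc a b))
    (hC : ∀ η, |f η| ≤ C) (Λ : Finset ℤ) (n : ℕ) (η : Config) :
    |(generatorOn μ Λ)^[n] f η| ≤ C * (4 * (b - a + 2)) ^ n * n.factorial := by
  have hC0 : 0 ≤ C := (abs_nonneg _).trans (hC η)
  have hR : (2 : ℝ) ≤ b - a + 2 := by
    have : (a : ℝ) ≤ b := by exact_mod_cast hab
    linarith
  induction n generalizing η with
  | zero => simpa using hC η
  | succ n ih =>
    rw [Function.iterate_succ_apply']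
    refine (abs_generatorOn_le (by omega) (dependsOn_iterate_generatorOn hf Λ n) ih Λ η).trans ?_
    have hP : 0 ≤ C * (4 * ((b : ℝ) - a + 2)) ^ n * n.factorial := by positivity
    have : 2 * (((b + n : ℤ) : ℝ) - ((a - n : ℤ) : ℝ) + 2) ≤ 4 * ((b : ℝ) - a + 2) * (n + 1) := by
      push_cast
      have : (0 : ℝ) ≤ n := n.cast_nonneg
      nlinarith
    calc _ ≤ 4 * ((b : ℝ) - a + 2) * (n + 1) * (C * (4 * ((b : ℝ) - a + 2)) ^ n * n.factorial) :=
          mul_le_mul_of_nonneg_right this hP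
      _ = _ := by rw [Nat.factorial_succ]; push_cast; ring

/-- The `n`-th power of the generator of the infinite system, applied to a function that depends
on the coordinates in `[a, b]`. -/
noncomputable def generatorPow (μ : ℝ) (a b : ℤ) (n : ℕ) (f : Config → ℝ) : Config → ℝ :=
  (generatorOn μ (Finset.Icc (a - n) (b + n)))^[n] f

lemma abs_term_le {t g K : ℝ} (ht : 0 ≤ t) {n : ℕ} (hg : |g| ≤ C * K ^ n * n.factorial) :
    ‖t ^ n / (n.factorial : ℝ) * g‖ ≤ C * (t * K) ^ n := by
  have hn : (0 : ℝ) < n.factorial := by exact_mod_cast n.factorial_pos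
  rw [norm_mul, Real.norm_of_nonneg (by positivity), Real.norm_eq_abs]
  calc _ ≤ t ^ n / (n.factorial : ℝ) * (C * K ^ n * n.factorial) := by gcongr
    _ = _ := by field_simp; ring

/-- For fixed `n` the term is eventually constant in `Λ`, and for small `t` the terms are dominated
by a geometric series, so limit and sum may be exchanged. -/
lemma semigroup_eq_tsum (hab : a ≤ b) (hf : DependsOn f (Set.Icc a b))
    (hC : ∀ η, |f η| ≤ C) {t : ℝ} (ht : 0 ≤ t) (ht' : t * (4 * (b - a + 2)) < 1) (η : Config) :
    semigroup μ t f η = ∑' n : ℕ, t ^ n / (n.factorial : ℝ) * generatorPow μ a b n f η := by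
  have hR : (a : ℝ) ≤ b := by exact_mod_cast hab
  have h0 : 0 ≤ t * (4 * ((b : ℝ) - a + 2)) := mul_nonneg ht (by linarith)
  refine Tendsto.limUnder_eq ?_
  refine tendsto_tsum_of_dominated_convergence
    (bound := fun n => C * (t * (4 * ((b : ℝ) - a + 2))) ^ n)
    ((summable_geometric_of_lt_one h0 ht').mul_left C) (fun n => ?_)
    (Eventually.of_forall fun Λ n =>
      abs_term_le ht (abs_iterate_generatorOn_le hab hf hC Λ n η))
  refine tendsto_const_nhds.congr' ?_
  filter_upwards [eventually_ge_atTop (Finset.Icc (a - n) (b + n))] with Λ hΛ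
  rw [generatorPow, iterate_generatorOn_eq hf n hΛ subset_rfl]

end Generator

/-- A power series that is constant near `0+` has vanishing linear coefficient. -/
lemma coeff_one_eq_zero {c : ℕ → ℝ} {C K : ℝ} (hK : 0 < K) (hc : ∀ n, |c n| ≤ C * K ^ n)
    (h : ∀ t, 0 ≤ t → t * K < 1 → ∑' n, t ^ n * c n = c 0) : c 1 = 0 := by
  -- The terms of order at least two sum to at most `2 * C * K ^ 2 * t ^ 2`; dividing by `t` leaves
  -- a bound that vanishes as `t → 0+`.
  have key : ∀ t, 0 < t → t * K ≤ 1 / 2 → |c 1| ≤ 2 * C * K ^ 2 * t := by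
    intro t ht htK
    have hb : ∀ n, ‖t ^ n * c n‖ ≤ C * (t * K) ^ n := fun n => by
      rw [norm_mul, Real.norm_of_nonneg (by positivity), mul_pow, Real.norm_eq_abs]
      calc _ ≤ t ^ n * (C * K ^ n) := by gcongr; exact hc n
        _ = _ := by ring
    have hgeo := (summable_geometric_of_lt_one (r := t * K) (by positivity) (by linarith))
    have hs : Summable fun n => t ^ n * c n := .of_norm_bounded (hgeo.mul_left C) hb
    have h1 := hs.sum_add_tsum_nat_add 2
    rw [h t ht.le (by linarith)] at h1
    simp only [Finset.sum_range_succ, Finset.sum_range_zero] at h1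
    have h2 : ‖∑' n, t ^ (n + 2) * c (n + 2)‖ ≤ ∑' n, C * (t * K) ^ (n + 2) :=
      tsum_of_norm_bounded (((summable_nat_add_iff 2).2 (hgeo.mul_left C)).hasSum)
        fun n => hb (n + 2)
    have h3 : ∑' n, C * (t * K) ^ (n + 2) = C * (t * K) ^ 2 * (1 - t * K)⁻¹ := by
      rw [← tsum_geometric_of_lt_one (by positivity) (by linarith), ← tsum_mul_left]
      exact tsum_congr fun n => by ring
    have hC : 0 ≤ C := by simpa using (abs_nonneg _).trans (hc 0)
    have h4 : (1 - t * K)⁻¹ ≤ 2 := by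
      rw [inv_le_comm₀ (by linarith) (by norm_num)]
      linarith
    have h5 : t * |c 1| ≤ t * (2 * C * K ^ 2 * t) := by
      have : t * c 1 = -∑' n, t ^ (n + 2) * c (n + 2) := by linarith
      rw [← abs_of_pos ht, ← abs_mul, abs_of_pos ht, this, abs_neg]
      refine h2.trans (h3.trans_le ?_)
      calc _ ≤ C * (t * K) ^ 2 * 2 := by gcongr
        _ = _ := by ring
    exact le_of_mul_le_mul_left h5 ht
  have hlim : Tendsto (fun t : ℝ => 2 * C * K ^ 2 * t) (𝓝[>] 0) (𝓝 0) := by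
    have : Continuous fun t : ℝ => 2 * C * K ^ 2 * t := by fun_prop
    simpa using (this.tendsto 0).mono_left nhdsWithin_le_nhds
  have hle : |c 1| ≤ 0 := by
    refine ge_of_tendsto hlim ?_
    filter_upwards [Ioo_mem_nhdsGT (show (0 : ℝ) < 1 / (2 * K) by positivity)] with t ht
    refine key t ht.1 ?_
    have := mul_lt_mul_of_pos_right ht.2 hK
    have h2 : 1 / (2 * K) * K = 1 / 2 := by field_simp
    linarith
  exact abs_nonpos_iff.1 hle

/-! ### Infinitesimal form of invariance -/

section Invariant

variable {μ : ℝ} {f : Config → ℝ} {a b : ℤ} {C : ℝ} {ν : ProbabilityMeasure Config}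

/-- Invariant measures annihilate the range of the generator on local functions. -/
lemma integral_generatorOn_eq_zero (hν : ν ∈ invariantMeasures μ) (hab : a ≤ b)
    (hf : DependsOn f (Set.Icc a b)) (hfm : Measurable f) (hC : ∀ η, |f η| ≤ C) :
    ∫ η, generatorOn μ (Finset.Icc (a - 1) b) f η ∂(ν : Measure Config) = 0 := by
  have hR : (a : ℝ) ≤ b := by exact_mod_cast hab
  set K : ℝ := 4 * ((b : ℝ) - a + 2) with hK
  have hK0 : 0 < K := by rw [hK]; linarith
  have hb : ∀ n η, |generatorPow μ a b n f η| ≤ C * K ^ n * n.factorial := fun n η =>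
    abs_iterate_generatorOn_le hab hf hC _ n η
  have hm : ∀ n, Measurable (generatorPow μ a b n f) := fun n =>
    measurable_iterate_generatorOn _ hfm n
  have hint : ∀ n, Integrable (generatorPow μ a b n f) (ν : Measure Config) := fun n =>
    Integrable.of_bound (hm n).aestronglyMeasurable _
      (Eventually.of_forall fun η => (Real.norm_eq_abs _).trans_le (hb n η))
  have hfac : ∀ n : ℕ, (0 : ℝ) < n.factorial := fun n => by exact_mod_cast n.factorial_pos
  have key := coeff_one_eq_zero (C := C) hK0
    (c := fun n => (∫ η, generatorPow μ a b n f η ∂(ν : Measure Config)) / n.factorial) ?_ ?_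
  · have h1 : generatorPow μ a b 1 f = generatorOn μ (Finset.Icc (a - 1) b) f := by
      rw [generatorPow, Function.iterate_one]
      exact generatorOn_eq_of_subset hf (Finset.Icc_subset_Icc (by simp) (by simp))
    rw [h1] at key
    simpa using key
  · intro n
    rw [abs_div, abs_of_pos (hfac n), div_le_iff₀ (hfac n)]
    refine (norm_integral_le_of_norm_le_const
      (Eventually.of_forall fun η => (Real.norm_eq_abs _).trans_le (hb n η))).trans ?_
    simp
  · intro t ht htK
    have hloc : IsLocalFunction f := ⟨hfm, ⟨C, hC⟩, Finset.Icc a b, by simpa using hf⟩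
    have h1 := hν t ht f hloc
    have h2 : ∀ η, semigroup μ t f η = _ := semigroup_eq_tsum hab hf hC ht htK
    simp_rw [h2] at h1
    rw [← integral_tsum_of_summable_integral_norm] at h1
    · simp only [integral_const_mul] at h1
      simpa [generatorPow, mul_div_assoc, div_mul_eq_mul_div] using h1
    · exact fun n => (hint n).const_mul _
    · refine Summable.of_nonneg_of_le (fun n => integral_nonneg fun _ => norm_nonneg _)
        (fun n => ?_) ((summable_geometric_of_lt_one (by positivity) htK).mul_left C)
      refine (integral_mono_of_nonneg (Eventually.of_forall fun _ => norm_nonneg _)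
        (integrable_const (C * (t * K) ^ n))
        (Eventually.of_forall fun η => abs_term_le ht (hb n η))).trans ?_
      simp

end Invariant

/-! ### Gaps, and configurations that never lose gap -/

section Gap

variable {μ : ℝ}

/-- The distance of the opinions at the two ends of the edge `e`. -/
noncomputable def gap (e : ℤ) (η : Config) : ℝ := ‖η (e + 1) - η e‖

lemma gap_nonneg (e : ℤ) (η : Config) : 0 ≤ gap e η := norm_nonneg _

lemma gap_le_one (e : ℤ) (η : Config) : gap e η ≤ 1 := by
  simpa [gap] using AddCircle.norm_le_half_period (2 : ℝ) two_ne_zero (x := η (e + 1) - η e)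

lemma continuous_gap (e : ℤ) : Continuous (gap e) := by
  unfold gap
  fun_prop

lemma dependsOn_gap (e : ℤ) : DependsOn (gap e) (Set.Icc e (e + 1)) := by
  intro η ζ h
  simp only [gap, h e ⟨by omega, by omega⟩, h (e + 1) ⟨by omega, by omega⟩]

lemma norm_coe_of_abs_le_one {r : ℝ} (hr : |r| ≤ 1) : ‖(r : Opinion)‖ = |r| :=
  (AddCircle.norm_coe_eq_abs_iff (2 : ℝ) two_ne_zero).2 (by simpa using hr)

lemma coe_rep (x : Opinion) : (rep x : Opinion) = x :=
  AddCircle.coe_equivIoc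

lemma rep_mem (x : Opinion) : rep x ∈ Set.Ioc (-1 : ℝ) 1 := by
  have h := (AddCircle.equivIoc (2 : ℝ) (-1) x).2
  norm_num at h
  simpa [rep] using h

lemma coe_geodesic (k : Bool) (x y : Opinion) : (geodesic k x y : Opinion) = y - x := by
  unfold geodesic
  split_ifs with h
  -- In the antipodal case `-1` and `1` are the same point modulo the period `2`.
  · rw [← coe_rep (y - x), h.1, ← AddCircle.coe_add_period (2 : ℝ) (-1)]
    norm_num
  · exact coe_rep _

lemma abs_geodesic_le (k : Bool) (x y : Opinion) : |geodesic k x y| ≤ 1 := by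
  unfold geodesic
  split_ifs with h
  · simp
  · exact abs_le.2 ⟨(rep_mem _).1.le, (rep_mem _).2⟩

lemma abs_geodesic (k : Bool) (x y : Opinion) : |geodesic k x y| = ‖y - x‖ := by
  rw [← coe_geodesic k, norm_coe_of_abs_le_one (abs_geodesic_le k x y)]

lemma norm_mul_geodesic (hμ : 0 ≤ μ) (hμ' : μ ≤ 1) (k : Bool) (x y : Opinion) :
    ‖((μ * geodesic k x y : ℝ) : Opinion)‖ = μ * ‖y - x‖ := by
  rw [norm_coe_of_abs_le_one, abs_mul, abs_geodesic, abs_of_nonneg hμ]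
  rw [abs_mul, abs_of_nonneg hμ]
  exact mul_le_one₀ hμ' (abs_nonneg _) (abs_geodesic_le k x y)

lemma gap_update_self (hμ : 0 ≤ μ) (hμ' : μ ≤ 1 / 2) (k : Bool) (e : ℤ) (η : Config) :
    gap e (update μ k e η) = (1 - 2 * μ) * gap e η := by
  unfold gap
  rw [update_apply_left, update_apply_right]
  have h : η (e + 1) - ((μ * geodesic k (η e) (η (e + 1)) : ℝ) : Opinion)
      - (η e + ((μ * geodesic k (η e) (η (e + 1)) : ℝ) : Opinion))
      = (((1 - 2 * μ) * geodesic k (η e) (η (e + 1)) : ℝ) : Opinion) := by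
    have h1 : (1 - 2 * μ) * geodesic k (η e) (η (e + 1)) =
      geodesic k (η e) (η (e + 1)) - μ * geodesic k (η e) (η (e + 1))
        - μ * geodesic k (η e) (η (e + 1)) := by ring
    rw [h1, AddCircle.coe_sub, AddCircle.coe_sub, coe_geodesic]
    abel
  rw [h, norm_mul_geodesic (by linarith) (by linarith)]

/-- The common endpoint moves by exactly `μ * gap e η`; the bound is the triangle inequality. -/
lemma gap_update_right_le (hμ : 0 ≤ μ) (hμ' : μ ≤ 1 / 2) (k : Bool) (e : ℤ) (η : Config) :
    gap (e + 1) (update μ k e η) ≤ gap (e + 1) η + μ * gap e η := by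
  unfold gap
  rw [update_apply_right, update_apply_of_ne k η (by omega) (by omega), sub_sub_eq_add_sub,
    add_sub_right_comm, ← norm_mul_geodesic hμ (by linarith) k]
  exact norm_add_le _ _

lemma gap_update_left_le (hμ : 0 ≤ μ) (hμ' : μ ≤ 1 / 2) (k : Bool) (e : ℤ) (η : Config) :
    gap (e - 1) (update μ k e η) ≤ gap (e - 1) η + μ * gap e η := by
  unfold gap
  rw [sub_add_cancel, update_apply_left, update_apply_of_ne k η (by omega) (by omega),
    add_sub_right_comm, ← norm_mul_geodesic hμ (by linarith) k]
  exact norm_add_le _ _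

lemma gap_update_of_ne (k : Bool) {e x : ℤ} (h1 : x ≠ e - 1) (h2 : x ≠ e) (h3 : x ≠ e + 1)
    (η : Config) : gap x (update μ k e η) = gap x η := by
  unfold gap
  rw [update_apply_of_ne k η h2 h3, update_apply_of_ne k η (by omega) (by omega)]

/-- Updating the edge `e` distributes the proportion `2μ` of its gap evenly to the adjacent edges,
without any loss. -/
def Lossless (μ : ℝ) (k : Bool) (e : ℤ) (η : Config) : Prop :=
  gap (e - 1) (update μ k e η) = gap (e - 1) η + μ * gap e η ∧
    gap (e + 1) (update μ k e η) = gap (e + 1) η + μ * gap e η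

lemma Lossless.gap_update {k : Bool} {e : ℤ} {η : Config} (h : Lossless μ k e η)
    (hμ : 0 ≤ μ) (hμ' : μ ≤ 1 / 2) (x : ℤ) :
    gap x (update μ k e η) = gap x η + μ * gap e η *
      ((if x = e - 1 then 1 else 0) - 2 * (if x = e then 1 else 0) +
        if x = e + 1 then 1 else 0) := by
  by_cases h1 : x = e - 1
  · have h2 : e - 1 ≠ e := by omega
    have h3 : e - 1 ≠ e + 1 := by omega
    subst h1
    rw [h.1, if_pos rfl, if_neg h2, if_neg h3]
    ring
  by_cases h2 : x = e
  · have h3 : x ≠ x + 1 := by omega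
    subst h2
    rw [gap_update_self hμ hμ', if_pos rfl, if_neg h1, if_neg h3]
    ring
  by_cases h3 : x = e + 1
  · subst h3
    rw [h.2, if_pos rfl, if_neg h1, if_neg h2]
    ring
  · rw [gap_update_of_ne k h1 h2 h3]; simp [h1, h2, h3]

/-- Configurations for which no sequence of updates ever loses gap. -/
def StablyLossless (μ : ℝ) (η : Config) : Prop :=
  ∀ (l : List ℤ) (e : ℤ), Lossless μ false e (l.foldl (fun ξ e => update μ false e ξ) η)

lemma StablyLossless.update {η : Config} (h : StablyLossless μ η) (e : ℤ) :
    StablyLossless μ (update μ false e η) :=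
  fun l e' => h (e :: l) e'

/-- Summation by parts: a lossless update acts on gaps as a discrete Laplacian, which is moved to
the weights `c`. For `e` in `[1, n]` all three affected edges lie in `[0, n + 1]`. -/
lemma sum_mul_gap_update {η : Config} {e : ℤ} (h : Lossless μ false e η)
    (hμ : 0 ≤ μ) (hμ' : μ ≤ 1 / 2) {n : ℕ} (he : e ∈ Finset.Icc (1 : ℤ) n) (c : ℤ → ℝ) :
    ∑ x ∈ Finset.Icc (0 : ℤ) (n + 1), c x * gap x (Compass.update μ false e η) =
      ∑ x ∈ Finset.Icc (0 : ℤ) (n + 1), c x * gap x η +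
        μ * gap e η * (c (e - 1) - 2 * c e + c (e + 1)) := by
  rw [Finset.mem_Icc] at he
  have key : ∀ y : ℤ, y ∈ Finset.Icc (0 : ℤ) (n + 1) →
      ∑ x ∈ Finset.Icc (0 : ℤ) (n + 1), c x * (if x = y then (1 : ℝ) else 0) = c y := by
    intro y hy
    simp only [mul_ite, mul_one, mul_zero, Finset.sum_ite_eq', hy, if_true]
  have h1 := key (e - 1) (by rw [Finset.mem_Icc]; omega)
  have h2 := key e (by rw [Finset.mem_Icc]; omega)
  have h3 := key (e + 1) (by rw [Finset.mem_Icc]; omega)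
  calc _ = ∑ x ∈ Finset.Icc (0 : ℤ) (n + 1), (c x * gap x η + μ * gap e η *
      (c x * (if x = e - 1 then 1 else 0) - 2 * (c x * (if x = e then 1 else 0)) +
        c x * (if x = e + 1 then 1 else 0))) := by
        refine Finset.sum_congr rfl fun x _ => ?_
        rw [h.gap_update hμ hμ']
        ring
    _ = _ := by
        rw [Finset.sum_add_distrib, ← Finset.mul_sum, Finset.sum_add_distrib,
          Finset.sum_sub_distrib, ← Finset.mul_sum, h1, h2, h3]

/-- If no sequence of updates ever loses gap, then the gap on `[0, n]` can be accumulated on the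
single edge `0` (up to what leaves at the other end), so that it cannot be too large. -/
lemma StablyLossless.sum_gap_le {η : Config} (h : StablyLossless μ η)
    (hμ : 0 < μ) (hμ' : μ ≤ 1 / 2) (n : ℕ) :
    ∑ x ∈ Finset.Icc (0 : ℤ) (n + 1), ((n : ℝ) + 1 - x) * gap x η ≤ n + 1 := by
  -- The weight in `u` is affine, so `u` is conserved; it vanishes at `n + 1`, so gap leaving at
  -- that end costs nothing. The weight in `q` has second difference `-2`, so each update of `e`
  -- lowers `q` by `2 * μ * gap e`.
  set u : Config → ℝ := fun ξ => ∑ x ∈ Finset.Icc (0 : ℤ) (n + 1), ((n : ℝ) + 1 - x) * gap x ξ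
    with hu
  set q : Config → ℝ := fun ξ =>
    ∑ x ∈ Finset.Icc (0 : ℤ) (n + 1), ((x : ℝ) * (n + 1 - x)) * gap x ξ with hq
  -- Any class closed under updates in `[1, n]` with `u` fixed would do; actual reachability from
  -- `η` need not be tracked.
  set R : Set Config := {ξ | StablyLossless μ ξ ∧ u ξ = u η} with hR
  have hηR : η ∈ R := ⟨h, rfl⟩
  have hstep : ∀ ξ ∈ R, ∀ e ∈ Finset.Icc (1 : ℤ) n,
      Compass.update μ false e ξ ∈ R ∧ q (Compass.update μ false e ξ) = q ξ - 2 * μ * gap e ξ := by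
    intro ξ hξ e he
    have hl : Lossless μ false e ξ := hξ.1 [] e
    refine ⟨⟨hξ.1.update e, ?_⟩, ?_⟩
    · rw [← hξ.2]
      simp only [hu]
      refine (sum_mul_gap_update hl hμ.le hμ' he fun x : ℤ => (n : ℝ) + 1 - x).trans ?_
      push_cast
      ring
    · simp only [hq]
      refine (sum_mul_gap_update hl hμ.le hμ' he fun x : ℤ => (x : ℝ) * (n + 1 - x)).trans ?_
      push_cast
      ring
  have hq0 : ∀ ξ, 0 ≤ q ξ := fun ξ => Finset.sum_nonneg fun x hx => by
    rw [Finset.mem_Icc] at hx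
    have h1 : (0 : ℝ) ≤ x := by exact_mod_cast hx.1
    have h2 : (x : ℝ) ≤ n + 1 := by exact_mod_cast hx.2
    exact mul_nonneg (mul_nonneg h1 (by linarith)) (gap_nonneg _ _)
  have hbdd : BddBelow (q '' R) := ⟨0, by rintro _ ⟨ξ, -, rfl⟩; exact hq0 ξ⟩
  have key : ∀ ε > 0, u η ≤ n + 1 + (n + 1) * (n + 1) * ε := by
    intro ε hε
    -- Within `2 * μ * ε` of the infimum of `q` no single update can lower `q` by more than that, so
    -- all interior gaps are at most `ε`.
    obtain ⟨_, ⟨ξ, hξ, rfl⟩, hlt⟩ := Real.lt_sInf_add_pos (s := q '' R) ⟨_, η, hηR, rfl⟩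
      (show 0 < 2 * μ * ε by positivity)
    have hsmall : ∀ e ∈ Finset.Icc (1 : ℤ) n, gap e ξ ≤ ε := by
      intro e he
      obtain ⟨h1, h2⟩ := hstep ξ hξ e he
      have h3 := csInf_le hbdd ⟨_, h1, rfl⟩
      rw [h2] at h3
      have h4 : 2 * μ * gap e ξ ≤ 2 * μ * ε := by linarith
      exact le_of_mul_le_mul_left h4 (by positivity)
    rw [← hξ.2]
    -- Edge `0` has weight `n + 1` and gap at most `1`, interior edges have small gap, and edge `n +
    -- 1` has weight zero.
    have hle : ∀ x ∈ Finset.Icc (0 : ℤ) (n + 1), ((n : ℝ) + 1 - x) * gap x ξ ≤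
        (if x = 0 then (n + 1 : ℝ) else 0) + if x ∈ Finset.Icc (1 : ℤ) n then (n + 1) * ε else 0 := by
      intro x hx
      rw [Finset.mem_Icc] at hx
      rcases hx.1.eq_or_lt with rfl | h0
      · have : (0 : ℤ) ∉ Finset.Icc (1 : ℤ) n := by simp
        simp only [if_true, this, if_false]
        have := gap_le_one 0 ξ
        push_cast
        nlinarith
      rcases hx.2.eq_or_lt with rfl | h1
      · have : (n : ℤ) + 1 ∉ Finset.Icc (1 : ℤ) n := by simp
        have h' : (n : ℤ) + 1 ≠ 0 := by omega
        simp [this, h']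
      · have hm : x ∈ Finset.Icc (1 : ℤ) n := by rw [Finset.mem_Icc]; omega
        simp only [h0.ne', hm, if_true, if_false, zero_add]
        have h2 : (0 : ℝ) < x := by exact_mod_cast h0
        exact mul_le_mul (by linarith) (hsmall x hm) (gap_nonneg _ _) (by positivity)
    refine (Finset.sum_le_sum hle).trans ?_
    rw [Finset.sum_add_distrib, Finset.sum_ite_eq', Finset.sum_ite_mem]
    have h0 : (0 : ℤ) ∈ Finset.Icc (0 : ℤ) (n + 1) := by rw [Finset.mem_Icc]; omega
    have hi : Finset.Icc (0 : ℤ) (n + 1) ∩ Finset.Icc (1 : ℤ) n = Finset.Icc (1 : ℤ) n :=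
      Finset.inter_eq_right.2 (Finset.Icc_subset_Icc (by omega) (by omega))
    rw [if_pos h0, hi, Finset.sum_const, Int.card_Icc, nsmul_eq_mul]
    simp only [add_sub_cancel_right, Int.toNat_natCast]
    have : (0 : ℝ) ≤ n := n.cast_nonneg
    nlinarith [mul_nonneg (add_nonneg this zero_le_one) hε.le]
  refine le_of_forall_pos_le_add fun δ hδ => ?_
  have := key (δ / ((n + 1) * (n + 1))) (by positivity)
  rwa [mul_div_cancel₀ _ (by positivity)] at this

end Gap

/-! ### Expected gaps under an invariant measure -/

/-- A bounded convex function on `ℤ` is constant. -/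
lemma eq_of_bounded_of_convex {a : ℤ → ℝ} (h0 : ∀ e, 0 ≤ a e) (h1 : ∀ e, a e ≤ 1)
    (h : ∀ e, 0 ≤ a (e - 1) - 2 * a e + a (e + 1)) (e : ℤ) : a (e + 1) = a e := by
  have hmono : Monotone fun e => a (e + 1) - a e := monotone_int_of_le_succ fun e => by
    have := h (e + 1)
    rw [add_sub_cancel_right] at this
    linarith
  have hmono' : ∀ {x y : ℤ}, x ≤ y → a (x + 1) - a x ≤ a (y + 1) - a y := fun hxy => hmono hxy
  -- Convexity puts `a` above the line through its values at `e` and `e + 1`. A nonzero slope makes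
  -- this line exceed `1` far to the right or far to the left.
  have hup : ∀ n : ℕ, a e + n * (a (e + 1) - a e) ≤ a (e + n) := by
    intro n
    induction n with
    | zero => simp
    | succ n ih =>
      have := hmono' (show e ≤ e + n by omega)
      push_cast
      rw [← add_assoc]
      linarith
  have hdown : ∀ n : ℕ, a e - n * (a (e + 1) - a e) ≤ a (e - n) := by
    intro n
    induction n with
    | zero => simp
    | succ n ih =>
      have := hmono' (show e - (n + 1) ≤ e by omega)
      rw [show e - ((n : ℤ) + 1) + 1 = e - n by ring] at this
      push_cast
      linarith
  by_contra hne
  rcases lt_or_gt_of_ne hne with hlt | hlt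
  · obtain ⟨n, hn⟩ := exists_nat_gt (1 / (a e - a (e + 1)))
    rw [div_lt_iff₀ (by linarith)] at hn
    have := hdown n
    have := h1 (e - n)
    have := h0 e
    nlinarith
  · obtain ⟨n, hn⟩ := exists_nat_gt (1 / (a (e + 1) - a e))
    rw [div_lt_iff₀ (by linarith)] at hn
    have := hup n
    have := h1 (e + n)
    have := h0 e
    nlinarith

lemma IsLocalFunction.exists_dependsOn_Icc {f : Config → ℝ} (hf : IsLocalFunction f) :
    ∃ a b : ℤ, a ≤ b ∧ DependsOn f (Set.Icc a b) := by
  obtain ⟨-, -, Λ, hΛ⟩ := hf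
  obtain ⟨a, ha⟩ := Λ.bddBelow
  obtain ⟨b, hb⟩ := Λ.bddAbove
  refine ⟨a, max a b, le_max_left _ _, hΛ.mono fun x hx => ⟨ha hx, (hb hx).trans (le_max_right _ _)⟩⟩

lemma IsLocalFunction.comp_update {f : Config → ℝ} (hf : IsLocalFunction f) (μ : ℝ) (k : Bool)
    (e : ℤ) : IsLocalFunction fun η => f (update μ k e η) := by
  obtain ⟨a, b, -, hd⟩ := hf.exists_dependsOn_Icc
  obtain ⟨hm, ⟨C, hC⟩, -⟩ := hf
  refine ⟨hm.comp (measurable_update μ k e), ⟨C, fun η => hC _⟩, Finset.Icc a b ∪ {e, e + 1}, ?_⟩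
  intro η ζ h
  have h' : ∀ v, (v ∈ Set.Icc a b ∨ v = e ∨ v = e + 1) → η v = ζ v := fun v hv =>
    h v (by
      simp only [Finset.coe_union, Finset.coe_Icc, Finset.coe_insert, Finset.coe_singleton]
      exact hv)
  exact hd fun v hv => update_congr k e (h' e (by simp)) (h' _ (by simp)) (h' v (Or.inl hv))

section Invariant

variable {μ : ℝ} {ν : ProbabilityMeasure Config}

/-- Local events that almost surely do not occur do not occur after an update either. -/
lemma ae_comp_update_eq_zero (hν : ν ∈ invariantMeasures μ) {f : Config → ℝ}
    (hf : IsLocalFunction f) (hf0 : ∀ η, 0 ≤ f η) (hfν : ∀ᵐ η ∂(ν : Measure Config), f η = 0)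
    (e : ℤ) : ∀ᵐ η ∂(ν : Measure Config), f (update μ false e η) = 0 := by
  obtain ⟨a, b, hab, hd⟩ := hf.exists_dependsOn_Icc
  by_cases he : e ∈ Set.Icc (a - 1) b
  swap
  · filter_upwards [hfν] with η hη
    rw [comp_update_of_notMem hd false he, hη]
  obtain ⟨hm, ⟨C, hC⟩, -⟩ := hf
  have hint := integral_generatorOn_eq_zero hν hab hd hm hC
  -- Almost surely `f η = 0`, so every summand of the generator is nonnegative. Their sum has
  -- integral zero, hence each summand vanishes almost surely.
  have hterm : ∀ᵐ η ∂(ν : Measure Config), ∀ e ∈ Finset.Icc (a - 1) b,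
      0 ≤ (1 / 2) * (f (update μ false e η) + f (update μ true e η)) - f η := by
    filter_upwards [hfν] with η hη e _
    have h1 := hf0 (update μ false e η)
    have h2 := hf0 (update μ true e η)
    rw [hη]
    linarith
  have hgm := measurable_generatorOn (μ := μ) (Finset.Icc (a - 1) b) hm
  rw [integral_eq_zero_iff_of_nonneg_ae] at hint
  · filter_upwards [hint, hterm, hfν] with η h1 h2 h3
    have h4 := (Finset.sum_eq_zero_iff_of_nonneg h2).1 h1 e (by simpa using he)
    have h5 := hf0 (update μ false e η)
    have h6 := hf0 (update μ true e η)
    rw [h3] at h4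
    linarith
  · filter_upwards [hterm] with η h
    exact Finset.sum_nonneg h
  · exact Integrable.of_bound hgm.aestronglyMeasurable _ (Eventually.of_forall fun η =>
      (Real.norm_eq_abs _).trans_le (abs_generatorOn_le hab hd hC _ η))

/-- The gap that is lost on the edge `x` when the edge `e` is updated. -/
noncomputable def loss (μ : ℝ) (k : Bool) (x e : ℤ) (η : Config) : ℝ :=
  gap x η + μ * gap e η - gap x (update μ k e η)

lemma measurable_loss (μ : ℝ) (k : Bool) (x e : ℤ) : Measurable (loss μ k x e) := by
  have h := fun x => (continuous_gap x).measurable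
  exact ((h x).add ((h e).const_mul _)).sub ((h x).comp (measurable_update μ k e))

lemma abs_loss_le (hμ : 0 ≤ μ) (hμ' : μ ≤ 1 / 2) (k : Bool) (x e : ℤ) (η : Config) :
    |loss μ k x e η| ≤ 2 := by
  have h1 := gap_nonneg x η
  have h2 := gap_nonneg e η
  have h3 := gap_nonneg x (update μ k e η)
  have h4 := gap_le_one x η
  have h5 := gap_le_one e η
  have h6 := gap_le_one x (update μ k e η)
  unfold loss
  rw [abs_le]
  constructor <;> nlinarith

lemma dependsOn_loss (μ : ℝ) (k : Bool) (x e : ℤ) :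
    DependsOn (loss μ k x e) ({x, x + 1, e, e + 1} : Finset ℤ) := by
  intro η ζ h
  have h1 : η x = ζ x := h _ (by simp)
  have h2 : η (x + 1) = ζ (x + 1) := h _ (by simp)
  have h3 : η e = ζ e := h _ (by simp)
  have h4 : η (e + 1) = ζ (e + 1) := h _ (by simp)
  simp only [loss, gap, h1, h2, h3, h4, update_congr k e h3 h4 h1, update_congr k e h3 h4 h2]

lemma isLocalFunction_loss (hμ : 0 ≤ μ) (hμ' : μ ≤ 1 / 2) (k : Bool) (x e : ℤ) :
    IsLocalFunction (loss μ k x e) :=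
  ⟨measurable_loss μ k x e, ⟨2, abs_loss_le hμ hμ' k x e⟩, _, dependsOn_loss μ k x e⟩

lemma lossless_iff (k : Bool) (e : ℤ) (η : Config) :
    Lossless μ k e η ↔ loss μ k (e - 1) e η = 0 ∧ loss μ k (e + 1) e η = 0 := by
  unfold Lossless loss
  constructor <;> rintro ⟨h1, h2⟩ <;> constructor <;> linarith

lemma loss_left_nonneg (hμ : 0 ≤ μ) (hμ' : μ ≤ 1 / 2) (k : Bool) (e : ℤ) (η : Config) :
    0 ≤ loss μ k (e - 1) e η := sub_nonneg.2 (gap_update_left_le hμ hμ' k e η)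

lemma loss_right_nonneg (hμ : 0 ≤ μ) (hμ' : μ ≤ 1 / 2) (k : Bool) (e : ℤ) (η : Config) :
    0 ≤ loss μ k (e + 1) e η := sub_nonneg.2 (gap_update_right_le hμ hμ' k e η)

lemma integrable_gap (ν : FiniteMeasure Config) (e : ℤ) : Integrable (gap e) (ν : Measure Config) :=
  Integrable.of_bound (continuous_gap e).measurable.aestronglyMeasurable 1
    (Eventually.of_forall fun η => by
      rw [Real.norm_of_nonneg (gap_nonneg e η)]
      exact gap_le_one e η)

/-- The action of the generator on a gap. -/
lemma generatorOn_gap (hμ : 0 ≤ μ) (hμ' : μ ≤ 1 / 2) (e : ℤ) (η : Config) :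
    generatorOn μ (Finset.Icc (e - 1) (e + 1)) (gap e) η =
      μ * (gap (e - 1) η - 2 * gap e η + gap (e + 1) η) -
        (1 / 2) * (loss μ false e (e - 1) η + loss μ true e (e - 1) η +
          (loss μ false e (e + 1) η + loss μ true e (e + 1) η)) := by
  have hI : Finset.Icc (e - 1) (e + 1) = {e - 1, e, e + 1} := by
    ext x
    simp only [Finset.mem_Icc, Finset.mem_insert, Finset.mem_singleton]
    omega
  have h1 : e - 1 ∉ ({e, e + 1} : Finset ℤ) := by
    simp only [Finset.mem_insert, Finset.mem_singleton]
    omega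
  have h2 : e ∉ ({e + 1} : Finset ℤ) := by
    simp only [Finset.mem_singleton]
    omega
  rw [generatorOn, hI, Finset.sum_insert h1, Finset.sum_insert h2, Finset.sum_singleton]
  simp only [gap_update_self hμ hμ', loss]
  ring

/-- Under an invariant measure the expected gaps are all the same, and no gap is ever lost. -/
lemma integral_gap_and_loss (hν : ν ∈ invariantMeasures μ) (hμ : 0 < μ) (hμ' : μ ≤ 1 / 2) :
    (∀ e, ∫ η, gap (e + 1) η ∂(ν : Measure Config) = ∫ η, gap e η ∂(ν : Measure Config)) ∧
      ∀ e, ∀ᵐ η ∂(ν : Measure Config),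
        loss μ false e (e - 1) η = 0 ∧ loss μ false e (e + 1) η = 0 := by
  set a : ℤ → ℝ := fun e => ∫ η, gap e η ∂(ν : Measure Config) with ha
  set L : ℤ → Config → ℝ := fun e η => loss μ false e (e - 1) η + loss μ true e (e - 1) η +
    (loss μ false e (e + 1) η + loss μ true e (e + 1) η) with hL
  have hg : ∀ e, Integrable (gap e) (ν : Measure Config) := integrable_gap ν.toFiniteMeasure
  have hl : ∀ k x e, Integrable (loss μ k x e) (ν : Measure Config) := fun k x e =>
    Integrable.of_bound (measurable_loss μ k x e).aestronglyMeasurable 2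
      (Eventually.of_forall fun η => (Real.norm_eq_abs _).trans_le (abs_loss_le hμ.le hμ' k x e η))
  have hLi : ∀ e, Integrable (L e) (ν : Measure Config) := fun e =>
    ((hl _ _ _).add (hl _ _ _)).add ((hl _ _ _).add (hl _ _ _))
  have hl1 : ∀ k e η, 0 ≤ loss μ k e (e - 1) η := fun k e η => by
    simpa using loss_right_nonneg hμ.le hμ' k (e - 1) η
  have hl2 : ∀ k e η, 0 ≤ loss μ k e (e + 1) η := fun k e η => by
    simpa using loss_left_nonneg hμ.le hμ' k (e + 1) η
  have hL0 : ∀ e η, 0 ≤ L e η := fun e η =>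
    add_nonneg (add_nonneg (hl1 _ _ _) (hl1 _ _ _)) (add_nonneg (hl2 _ _ _) (hl2 _ _ _))
  -- Balance for the gap of `e`: diffusion from the neighbours equals expected loss, which makes `a`
  -- convex; constancy of `a` then forces zero loss.
  have hbal : ∀ e, μ * (a (e - 1) - 2 * a e + a (e + 1)) =
      (1 / 2) * ∫ η, L e η ∂(ν : Measure Config) := by
    intro e
    have h := integral_generatorOn_eq_zero hν (by omega) (dependsOn_gap e)
      (continuous_gap e).measurable
      (fun η => (abs_of_nonneg (gap_nonneg e η)).trans_le (gap_le_one e η))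
    have h1 : Integrable (fun η => gap (e - 1) η - 2 * gap e η) (ν : Measure Config) :=
      (hg _).sub ((hg _).const_mul 2)
    have h2 : Integrable (fun η => μ * (gap (e - 1) η - 2 * gap e η + gap (e + 1) η))
        (ν : Measure Config) := (h1.add (hg _)).const_mul μ
    have h3 : ∀ η, generatorOn μ (Finset.Icc (e - 1) (e + 1)) (gap e) η =
        μ * (gap (e - 1) η - 2 * gap e η + gap (e + 1) η) - (1 / 2) * L e η :=
      generatorOn_gap hμ.le hμ' e
    simp_rw [h3] at h
    rw [integral_sub h2 ((hLi e).const_mul (1 / 2)), integral_const_mul, integral_const_mul,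
      integral_add h1 (hg _), integral_sub (hg _) ((hg _).const_mul 2), integral_const_mul] at h
    linarith
  have hconst : ∀ e, a (e + 1) = a e := by
    refine eq_of_bounded_of_convex (fun e => integral_nonneg (gap_nonneg e)) (fun e => ?_)
      fun e => ?_
    · refine (integral_mono (hg e) (integrable_const 1) (gap_le_one e)).trans ?_
      simp
    · have h1 := hbal e
      have h2 : 0 ≤ ∫ η, L e η ∂(ν : Measure Config) := integral_nonneg (hL0 e)
      have h3 : 0 ≤ μ * (a (e - 1) - 2 * a e + a (e + 1)) := by linarith
      exact nonneg_of_mul_nonneg_right h3 hμ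
  refine ⟨hconst, fun e => ?_⟩
  have h1 := hbal e
  have h2 := hconst (e - 1)
  rw [sub_add_cancel] at h2
  have h3 : ∫ η, L e η ∂(ν : Measure Config) = 0 := by
    rw [hconst e, h2] at h1
    linarith
  rw [integral_eq_zero_iff_of_nonneg (hL0 e) (hLi e)] at h3
  filter_upwards [h3] with η hη
  have h4 := hl1 false e η
  have h5 := hl1 true e η
  have h6 := hl2 false e η
  have h7 := hl2 true e η
  simp only [hL, Pi.zero_apply] at hη
  constructor <;> linarith

/-- Since `foldl` applies the head first, adding a head composes the function already obtained for
the tail with one update. Locality is carried through the induction for this purpose. -/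
lemma ae_foldl_eq_zero (hν : ν ∈ invariantMeasures μ) {f : Config → ℝ}
    (hf : IsLocalFunction f) (hf0 : ∀ η, 0 ≤ f η) (hfν : ∀ᵐ η ∂(ν : Measure Config), f η = 0)
    (l : List ℤ) :
    ∀ᵐ η ∂(ν : Measure Config), f (l.foldl (fun ξ e => update μ false e ξ) η) = 0 := by
  have h : IsLocalFunction (fun η => f (l.foldl (fun ξ e => update μ false e ξ) η)) ∧
      ∀ᵐ η ∂(ν : Measure Config), f (l.foldl (fun ξ e => update μ false e ξ) η) = 0 := by
    induction l with
    | nil => exact ⟨hf, hfν⟩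
    | cons e l ih =>
      exact ⟨ih.1.comp_update μ false e, ae_comp_update_eq_zero hν ih.1 (fun η => hf0 _) ih.2 e⟩
  exact h.2

/-- There are only countably many finite lists of edges, so the null sets can be united. -/
lemma ae_stablyLossless (hν : ν ∈ invariantMeasures μ) (hμ : 0 < μ) (hμ' : μ ≤ 1 / 2) :
    ∀ᵐ η ∂(ν : Measure Config), StablyLossless μ η := by
  have h := (integral_gap_and_loss hν hμ hμ').2
  unfold StablyLossless
  rw [ae_all_iff]
  intro l
  rw [ae_all_iff]
  intro e
  have h1 : ∀ᵐ η ∂(ν : Measure Config), loss μ false (e - 1) e η = 0 := by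
    filter_upwards [h (e - 1)] with η hη
    simpa using hη.2
  have h2 : ∀ᵐ η ∂(ν : Measure Config), loss μ false (e + 1) e η = 0 := by
    filter_upwards [h (e + 1)] with η hη
    simpa using hη.1
  filter_upwards [ae_foldl_eq_zero hν (isLocalFunction_loss hμ.le hμ' false _ _)
      (loss_left_nonneg hμ.le hμ' false e) h1 l,
    ae_foldl_eq_zero hν (isLocalFunction_loss hμ.le hμ' false _ _)
      (loss_right_nonneg hμ.le hμ' false e) h2 l] with η h3 h4
  exact (lossless_iff _ _ _).2 ⟨h3, h4⟩

lemma sum_Icc_sub (c : ℝ) (m : ℕ) :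
    ∑ x ∈ Finset.Icc (0 : ℤ) m, (c - x) = (m + 1) * c - m * (m + 1) / 2 := by
  induction m with
  | zero => simp
  | succ m ih =>
    have h : Finset.Icc (0 : ℤ) (m + 1 : ℕ) = insert ((m : ℤ) + 1) (Finset.Icc (0 : ℤ) m) := by
      ext x
      simp only [Finset.mem_Icc, Finset.mem_insert]
      push_cast
      omega
    rw [h, Finset.sum_insert (by simp), ih]
    push_cast
    ring

/-- Under an invariant measure, neighbouring opinions almost surely agree. -/
lemma integral_gap_eq_zero (hν : ν ∈ invariantMeasures μ) (hμ : 0 < μ) (hμ' : μ ≤ 1 / 2) (e : ℤ) :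
    ∫ η, gap e η ∂(ν : Measure Config) = 0 := by
  have hstep := (integral_gap_and_loss hν hμ hμ').1
  have hg : ∀ e, Integrable (gap e) (ν : Measure Config) := integrable_gap ν.toFiniteMeasure
  set A : ℝ := ∫ η, gap 0 η ∂(ν : Measure Config) with hA
  have hconst : ∀ e, ∫ η, gap e η ∂(ν : Measure Config) = A := by
    intro e
    induction e using Int.induction_on with
    | zero => rfl
    | succ n ih => rw [hstep, ih]
    | pred n ih => rw [← ih, ← hstep, sub_add_cancel]
  rw [hconst]
  have hA0 : 0 ≤ A := integral_nonneg (gap_nonneg 0)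
  have hn : ∀ n : ℕ, A * (n + 2) ≤ 2 := by
    intro n
    have h1 : ∫ η, ∑ x ∈ Finset.Icc (0 : ℤ) (n + 1), ((n : ℝ) + 1 - x) * gap x η
        ∂(ν : Measure Config) ≤ ∫ _, ((n : ℝ) + 1) ∂(ν : Measure Config) := by
      refine integral_mono_ae (integrable_finsetSum _ fun x _ => (hg x).const_mul _)
        (integrable_const _) ?_
      filter_upwards [ae_stablyLossless hν hμ hμ'] with η hη
      exact hη.sum_gap_le hμ hμ' n
    rw [integral_finsetSum _ fun x _ => (hg x).const_mul _] at h1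
    simp only [integral_const_mul, hconst] at h1
    rw [← Finset.sum_mul] at h1
    -- The weights sum to `(n + 1) * (n + 2) / 2`, quadratic in `n` against the linear bound `n +
    -- 1`.
    have h2 := sum_Icc_sub ((n : ℝ) + 1) (n + 1)
    push_cast at h2
    rw [h2] at h1
    simp only [integral_const, probReal_univ, one_smul] at h1
    have h3 : (0 : ℝ) < n + 1 := by positivity
    nlinarith
  by_contra hne
  have hpos : 0 < A := lt_of_le_of_ne hA0 (Ne.symm hne)
  obtain ⟨n, hn'⟩ := exists_nat_gt (2 / A)
  rw [div_lt_iff₀ hpos] at hn'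
  nlinarith [hn n]

end Invariant

/-! ### Mixtures of constant configurations -/

lemma continuous_constConfig : Continuous constConfig :=
  continuous_pi fun _ => continuous_id

lemma measurableEmbedding_constConfig : MeasurableEmbedding constConfig :=
  (continuous_constConfig.isClosedEmbedding fun _ _ h => congrFun h 0).measurableEmbedding

lemma eq_constConfig_of_gap_eq_zero {η : Config} (h : ∀ e, gap e η = 0) :
    constConfig (η 0) = η := by
  have hstep : ∀ e, η (e + 1) = η e := fun e => sub_eq_zero.1 (norm_eq_zero.1 (h e))
  funext e
  simp only [constConfig]
  induction e using Int.induction_on with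
  | zero => rfl
  | succ n ih => rw [hstep, ih]
  | pred n ih => rw [ih, ← hstep (-n - 1), sub_add_cancel]

lemma gap_constConfig (e : ℤ) (s : Opinion) : gap e (constConfig s) = 0 := by
  simp [gap, constConfig]

lemma exists_eq_map_constConfig_iff (ν : ProbabilityMeasure Config) :
    (∃ ρ : ProbabilityMeasure Opinion,
      (ν : Measure Config) = Measure.map constConfig (ρ : Measure Opinion)) ↔
      ∀ e, ∫ η, gap e η ∂(ν : Measure Config) = 0 := by
  constructor
  · rintro ⟨ρ, hρ⟩ e
    rw [hρ, measurableEmbedding_constConfig.integral_map]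
    simp [gap_constConfig]
  · intro h
    have hae : ∀ᵐ η ∂(ν : Measure Config), constConfig (η 0) = η := by
      have h1 : ∀ᵐ η ∂(ν : Measure Config), ∀ e, gap e η = 0 := by
        rw [ae_all_iff]
        intro e
        exact (integral_eq_zero_iff_of_nonneg (gap_nonneg e)
          (integrable_gap ν.toFiniteMeasure e)).1 (h e)
      filter_upwards [h1] with η hη
      exact eq_constConfig_of_gap_eq_zero hη
    -- The mixing measure is the law of the opinion at site `0`.
    refine ⟨ν.map (measurable_pi_apply 0).aemeasurable, ?_⟩
    rw [ProbabilityMeasure.toMeasure_map,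
      Measure.map_map continuous_constConfig.measurable (measurable_pi_apply 0)]
    conv_lhs => rw [← Measure.map_id (μ := (ν : Measure Config))]
    refine Measure.map_congr ?_
    filter_upwards [hae] with η hη
    exact hη.symm

lemma geodesic_self (k : Bool) (x : Opinion) : geodesic k x x = 0 := by
  rw [← abs_eq_zero, abs_geodesic, sub_self, norm_zero]

lemma update_constConfig (μ : ℝ) (k : Bool) (e : ℤ) (s : Opinion) :
    update μ k e (constConfig s) = constConfig s := by
  funext v
  simp [update, constConfig, geodesic_self]

/-- Updates fix a constant configuration, so only the zeroth term of the exponential series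
survives. -/
lemma semigroup_constConfig (μ t : ℝ) (f : Config → ℝ) (s : Opinion) :
    semigroup μ t f (constConfig s) = f (constConfig s) := by
  have h : ∀ Λ, semigroupOn μ Λ t f (constConfig s) = f (constConfig s) := by
    intro Λ
    have h0 : ∀ n : ℕ, n ≠ 0 → (generatorOn μ Λ)^[n] f (constConfig s) = 0 := by
      intro n hn
      obtain ⟨m, rfl⟩ := Nat.exists_eq_succ_of_ne_zero hn
      rw [Function.iterate_succ_apply', generatorOn]
      refine Finset.sum_eq_zero fun e _ => ?_
      rw [update_constConfig, update_constConfig]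
      ring
    rw [semigroupOn, tsum_eq_single 0 fun n hn => by rw [h0 n hn, mul_zero]]
    simp
  refine Tendsto.limUnder_eq ?_
  simp_rw [h]
  exact tendsto_const_nhds

lemma mem_invariantMeasures_iff {μ : ℝ} (hμ : 0 < μ) (hμ' : μ ≤ 1 / 2)
    (ν : ProbabilityMeasure Config) :
    ν ∈ invariantMeasures μ ↔ ∀ e, ∫ η, gap e η ∂(ν : Measure Config) = 0 := by
  refine ⟨fun h e => integral_gap_eq_zero h hμ hμ' e, fun h => ?_⟩
  obtain ⟨ρ, hρ⟩ := (exists_eq_map_constConfig_iff ν).2 h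
  intro t _ f _
  rw [hρ, measurableEmbedding_constConfig.integral_map,
    measurableEmbedding_constConfig.integral_map]
  simp_rw [semigroup_constConfig]

/-! ### The closed convex hull of the point masses -/

section ConvexHull

/-- `Convex.sum_mem` for convexity over the semifield `ℝ≥0`. -/
lemma sum_mem_of_convex_nnreal {E ι : Type*} [AddCommMonoid E] [Module ℝ≥0 E] {s : Set E}
    (hs : Convex ℝ≥0 s) (t : Finset ι) {w : ι → ℝ≥0} {z : ι → E} (hw : ∑ i ∈ t, w i = 1)
    (hz : ∀ i ∈ t, z i ∈ s) : ∑ i ∈ t, w i • z i ∈ s := by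
  classical
  induction t using Finset.induction_on generalizing w with
  | empty => simp at hw
  | insert i t hi ih =>
    rw [Finset.sum_insert hi] at hw ⊢
    rcases eq_or_ne (∑ j ∈ t, w j) 0 with h0 | h0
    · have h1 : ∀ j ∈ t, w j = 0 := by simpa using h0
      rw [h0, add_zero] at hw
      rw [Finset.sum_eq_zero fun j hj => by rw [h1 j hj, zero_smul], hw, one_smul, add_zero]
      exact hz i (Finset.mem_insert_self _ _)
    · have h1 : ∑ j ∈ t, ((∑ j ∈ t, w j)⁻¹ * w j) • z j ∈ s := by
        refine ih ?_ fun j hj => hz j (Finset.mem_insert_of_mem hj)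
        rw [← Finset.mul_sum, inv_mul_cancel₀ h0]
      have h2 := convex_iff_add_mem.1 hs (hz i (Finset.mem_insert_self _ _)) h1
        zero_le zero_le hw
      rw [Finset.smul_sum] at h2
      simpa only [smul_smul, mul_inv_cancel_left₀ h0] using h2

/-- The image of a probability measure under a simple function is a convex combination of point
masses. -/
lemma map_simpleFunc_mem_of_convex {X : Type*} [MeasurableSpace X] (ρ : ProbabilityMeasure X)
    (g : SimpleFunc X Config) {t : Set (FiniteMeasure Config)} (ht : Convex ℝ≥0 t)
    (hg : ∀ x, (pointMass (g x)).toFiniteMeasure ∈ t) : ρ.toFiniteMeasure.map g ∈ t := by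
  have h : ρ.toFiniteMeasure.map g =
      ∑ η ∈ g.range, ρ (g ⁻¹' {η}) • (pointMass η).toFiniteMeasure := by
    apply FiniteMeasure.toMeasure_injective
    rw [FiniteMeasure.toMeasure_map, FiniteMeasure.toMeasure_sum]
    ext s hs
    rw [Measure.map_apply g.measurable hs, Measure.finsetSum_apply]
    have h1 : g ⁻¹' s = ⋃ y ∈ g.range, g ⁻¹' ({y} ∩ s) := by
      ext x
      simp
    rw [h1, measure_biUnion_finset]
    · refine Finset.sum_congr rfl fun y _ => ?_
      rw [FiniteMeasure.toMeasure_smul, Measure.smul_apply]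
      change _ = _ • Measure.dirac y s
      rw [Measure.dirac_apply' _ hs]
      by_cases hy : y ∈ s
      · simp [hy, ENNReal.smul_def]
      · simp [hy]
    · intro y _ z _ hyz
      refine Disjoint.preimage _ ?_
      exact (Set.disjoint_singleton.2 hyz).mono Set.inter_subset_left Set.inter_subset_left
    · exact fun y _ => g.measurableSet_preimage _
  rw [h]
  refine sum_mem_of_convex_nnreal ht _ ?_ fun η hη => ?_
  · have h2 := g.sum_range_measure_preimage_singleton (ρ : Measure X)
    rw [measure_univ] at h2
    rw [← ENNReal.coe_inj, ENNReal.ofNNReal_finsetSum]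
    simpa using h2
  · obtain ⟨x, rfl⟩ := SimpleFunc.mem_range.1 hη
    exact hg x

/-- Simple functions approximating the identity of the circle turn `ρ` into finite convex
combinations of point masses; these converge weakly by dominated convergence. -/
lemma map_constConfig_mem_closure (ρ : ProbabilityMeasure Opinion) :
    ρ.toFiniteMeasure.map constConfig ∈ closure (convexHull ℝ≥0 (Set.range fun s : Opinion =>
      (pointMass (constConfig s)).toFiniteMeasure)) := by
  set g : ℕ → SimpleFunc Opinion Opinion := fun n =>
    SimpleFunc.approxOn id measurable_id Set.univ 0 (Set.mem_univ _) n with hg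
  have hlim : ∀ s, Tendsto (fun n => g n s) atTop (𝓝 s) := fun s =>
    SimpleFunc.tendsto_approxOn measurable_id (Set.mem_univ _) (by simp)
  set G : ℕ → SimpleFunc Opinion Config := fun n => (g n).map constConfig with hG
  have hGm : ∀ n, (fun s => G n s) = fun s => constConfig (g n s) := fun n => rfl
  refine mem_closure_of_tendsto (f := fun n => ρ.toFiniteMeasure.map (G n)) (b := atTop) ?_
    (Eventually.of_forall fun n => ?_)
  · rw [FiniteMeasure.tendsto_iff_forall_integral_tendsto]
    intro f
    simp only [FiniteMeasure.toMeasure_map]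
    rw [integral_map continuous_constConfig.measurable.aemeasurable
      f.continuous.measurable.aestronglyMeasurable]
    simp_rw [fun n => integral_map (μ := (ρ.toFiniteMeasure : Measure Opinion))
      (G n).measurable.aemeasurable
      (f := f) f.continuous.measurable.aestronglyMeasurable]
    refine tendsto_integral_of_dominated_convergence (fun _ => ‖f‖) (fun n => ?_)
      (integrable_const _) (fun n => Eventually.of_forall fun s => f.norm_coe_le_norm _)
      (Eventually.of_forall fun s => ?_)
    · exact (f.continuous.measurable.comp (G n).measurable).aestronglyMeasurable
    · exact ((f.continuous.comp continuous_constConfig).tendsto s).comp (hlim s)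
  · exact map_simpleFunc_mem_of_convex ρ (G n) (convex_convexHull _ _)
      fun x => subset_convexHull _ _ ⟨g n x, rfl⟩

/-- Gaps are continuous, and bounded since configurations form a compact space, so their integrals
are weakly continuous. With convexity, this confines the closed convex hull to invariant measures.
-/
lemma isClosed_setOf_integral_gap_eq_zero :
    IsClosed {ν : FiniteMeasure Config |
      ν.mass = 1 ∧ ∀ e, ∫ η, gap e η ∂(ν : Measure Config) = 0} := by
  refine (isClosed_eq FiniteMeasure.continuous_mass continuous_const).inter ?_
  have h : {ν : FiniteMeasure Config | ∀ e, ∫ η, gap e η ∂(ν : Measure Config) = 0} =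
      ⋂ e, {ν : FiniteMeasure Config | ∫ η, gap e η ∂(ν : Measure Config) = 0} := by
    ext ν
    simp
  change IsClosed {ν : FiniteMeasure Config | ∀ e, ∫ η, gap e η ∂(ν : Measure Config) = 0}
  rw [h]
  refine isClosed_iInter fun e => isClosed_eq ?_ continuous_const
  exact FiniteMeasure.continuous_integral_continuousMap (⟨gap e, continuous_gap e⟩ : C(Config, ℝ))

lemma convex_setOf_integral_gap_eq_zero :
    Convex ℝ≥0 {ν : FiniteMeasure Config |
      ν.mass = 1 ∧ ∀ e, ∫ η, gap e η ∂(ν : Measure Config) = 0} := by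
  rw [convex_iff_add_mem]
  rintro ν₁ ⟨h1, h1'⟩ ν₂ ⟨h2, h2'⟩ a b _ _ hab
  refine ⟨?_, fun e => ?_⟩
  · change (a • ν₁ + b • ν₂) Set.univ = 1
    rw [FiniteMeasure.coeFn_add, FiniteMeasure.coeFn_smul, FiniteMeasure.coeFn_smul]
    change a • ν₁.mass + b • ν₂.mass = 1
    rw [h1, h2, smul_eq_mul, smul_eq_mul, mul_one, mul_one, hab]
  · rw [FiniteMeasure.toMeasure_add, integral_add_measure (integrable_gap _ e)
      (integrable_gap _ e), FiniteMeasure.toMeasure_smul, FiniteMeasure.toMeasure_smul,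
      integral_smul_nnreal_measure, integral_smul_nnreal_measure, h1', h2']
    simp

end ConvexHull

end Compass

theorem theorem2 (μ : ℝ) (hμ_pos : 0 < μ) (hμ_le : μ ≤ 1 / 2) :
    ProbabilityMeasure.toFiniteMeasure '' Compass.invariantMeasures μ =
        closure (convexHull ℝ≥0 (Set.range fun s : Compass.Opinion =>
          (Compass.pointMass (Compass.constConfig s)).toFiniteMeasure)) ∧
      ∀ ν : ProbabilityMeasure Compass.Config,
        ν ∈ Compass.invariantMeasures μ ↔
          ∃ ρ : ProbabilityMeasure Compass.Opinion,
            (ν : Measure Compass.Config) =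
              Measure.map Compass.constConfig (ρ : Measure Compass.Opinion) := by
  have hinv := Compass.mem_invariantMeasures_iff hμ_pos hμ_le
  refine ⟨Set.Subset.antisymm ?_ ?_, fun ν =>
    (hinv ν).trans (Compass.exists_eq_map_constConfig_iff ν).symm⟩
  · rintro _ ⟨ν, hν, rfl⟩
    obtain ⟨ρ, hρ⟩ := (Compass.exists_eq_map_constConfig_iff ν).2 ((hinv ν).1 hν)
    convert Compass.map_constConfig_mem_closure ρ
    exact FiniteMeasure.toMeasure_injective hρ
  · have hsub : closure (convexHull ℝ≥0 (Set.range fun s : Compass.Opinion =>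
          (Compass.pointMass (Compass.constConfig s)).toFiniteMeasure)) ⊆
        {ν : FiniteMeasure Compass.Config |
          ν.mass = 1 ∧ ∀ e, ∫ η, Compass.gap e η ∂(ν : Measure Compass.Config) = 0} := by
      refine closure_minimal (convexHull_min ?_ Compass.convex_setOf_integral_gap_eq_zero)
        Compass.isClosed_setOf_integral_gap_eq_zero
      rintro _ ⟨s, rfl⟩
      refine ⟨ProbabilityMeasure.mass_toFiniteMeasure _, fun e => ?_⟩
      change ∫ η, Compass.gap e η ∂(Measure.dirac (Compass.constConfig s)) = 0
      rw [integral_dirac, Compass.gap_constConfig]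
    intro ν hν
    obtain ⟨hmass, hgap⟩ := hsub hν
    obtain ⟨π, rfl⟩ : ν ∈ Set.range ProbabilityMeasure.toFiniteMeasure := by
      rw [ProbabilityMeasure.range_toFiniteMeasure]
      exact hmass
    exact ⟨π, (hinv π).2 hgap, rfl⟩
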